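/- Let $P$ be a finite set of points in the Euclidean plane $\mathbb{R}^2$, with $d$ the Euclidean distance, and consider the following game with the points of $P$ as agents. A strategy of agent $u$ is a set $S_u$ of undirected edges $\{u,v\}$ with $v\in P\setminus\{u\}$ (the edges that $u$ buys, or owns). A strategy profile $\mathbf{s}=(S_u)_{u\in P}$ creates the undirected network $G(\mathbf{s})=(P,\bigcup_{u\in P}S_u)$. A greedy routing path from $u$ to $v$ in a network is a path $u=x_1,x_2,\dots,x_j=v$ along its edges with $d(x_i,v)>d(x_{i+1},v)$ for all $1\le i<j$. The cost $c_u(\mathbf{s})$ of agent $u$ is $|S_u|$ if $G(\mathbf{s})$ contains a greedy routing path from $u$ to every other point of $P$, and $\infty$ otherwise. A social optimum network is a network $G(\mathbf{s}^*)$ created by a profile $\mathbf{s}^*$ that minimizes the social cost $\sum_{u\in P}c_u(\mathbf{s})$ over all profiles $\mathbf{s}$. A profile $\mathbf{s}$ is a $+2$-additive Nash equilibrium if no agent $u$ can, by changing only its own strategy, decrease its cost below $c_u(\mathbf{s})-2$. Theorem. Let $G$ be a social optimum network for $P$. Then each edge of $G$ can be assigned to exactly one of its two endpoints as its owner such that the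 resulting strategy profile $\mathbf{s}$, which satisfies $G(\mathbf{s})=G$, is a $+2$-additive Nash equilibrium. -/

import Mathlib

/-!
Undirected greedy routing network creation game on a finite metric space `V`: the agents are the
points of `V`, and every agent buys undirected edges to other agents.
-/

namespace GreedyGame

/-- A strategy of agent `u`, given by the other endpoints of the edges that `u` buys:
the target set `S` stands for the edge set `{ {u, v} | v ∈ S }`. -/
abbrev Strategy (V : Type*) (u : V) : Type _ := {S : Finset V // u ∉ S}

/-- A strategy profile: one strategy for every agent. -/
abbrev Profile (V : Type*) : Type _ := (u : V) → Strategy V u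

/-- The undirected network created by a strategy profile. -/
def network {V : Type*} (s : Profile V) : SimpleGraph V where
  Adj u v := v ∈ (s u).1 ∨ u ∈ (s v).1
  symm := ⟨fun _ _ h => Or.symm h⟩
  loopless := ⟨fun u h => Or.elim h (s u).2 (s u).2⟩

/-- A walk from `u` to `v` is a greedy routing path if every step goes strictly closer
to the endpoint `v`. -/
def IsGreedyPath {V : Type*} [MetricSpace V] {G : SimpleGraph V} {u v : V} (w : G.Walk u v) :
    Prop :=
  w.support.IsChain (fun x y => dist x v > dist y v)

/-- Greedy routing is enabled for agent `u` in the network `G`. -/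
def GreedyConnected {V : Type*} [MetricSpace V] (G : SimpleGraph V) (u : V) : Prop :=
  ∀ v : V, v ≠ u → ∃ w : G.Walk u v, IsGreedyPath w

open Classical in
/-- The cost of agent `u`: the number of edges it buys, plus an infinite penalty if greedy routing
is not enabled for `u`. -/
noncomputable def cost {V : Type*} [MetricSpace V] (s : Profile V) (u : V) : ℕ∞ :=
  ((s u).1.card : ℕ∞) + if GreedyConnected (network s) u then 0 else ⊤

/-- The social cost: the total cost of all agents. -/
noncomputable def socialCost {V : Type*} [MetricSpace V] [Fintype V] (s : Profile V) : ℕ∞ :=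
  ∑ u : V, cost s u

/-- `G` is a social optimum network: it is created by a profile of minimum social cost. -/
def IsSocialOptimum {V : Type*} [MetricSpace V] [Fintype V] (G : SimpleGraph V) : Prop :=
  ∃ s : Profile V, network s = G ∧ ∀ s' : Profile V, socialCost s ≤ socialCost s'

/-- `s` is an assignment of ownership for `G`: it creates `G`, and every edge of `G` is bought by
exactly one of its endpoints. -/
def IsOwnershipAssignment {V : Type*} (s : Profile V) (G : SimpleGraph V) : Prop :=
  network s = G ∧ ∀ u v : V, ¬ (v ∈ (s u).1 ∧ u ∈ (s v).1)

open Classical in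
/-- `s` is a `+γ`-Nash equilibrium: no agent `u` can decrease its cost below its current cost
minus `γ` by changing its own strategy. (`γ` is written on the left so that no truncated
subtraction occurs.) -/
def IsAdditiveNE {V : Type*} [MetricSpace V] (γ : ℕ) (s : Profile V) : Prop :=
  ∀ (u : V) (S : Strategy V u), ¬ (cost (Function.update s u S) u + (γ : ℕ∞) < cost s u)

end GreedyGame

/-! Let e(W) count the purchases of an optimal profile with both ends in a set W of agents.
Optimality says that no other purchases inside W that leave each of its agents a neighbour closer to
every target are fewer (`sum_card_inter_le_of_optimal`). If every u in W could replace its deg_W(u)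
edges inside W by at least three fewer, all doing so at once would give e(W) ≤ 2 e(W) - 3|W|, so
e(W) ≥ 3|W|. But the Delaunay graph of W also serves and has fewer than 3|W| edges. Hence some agent
of W can save at most two: it receives all its edges inside W, is removed, and the argument repeats
(`exists_ownership`).

The Delaunay bound is proved without planarity. Up to the common term |t|², squared distances to t
are affine in t, and Delaunay neighbours are two sites tied alone at the minimum. A sweep by
parallel lines counts such pairs (`card_envelopeAdj_lt`); walking towards a target finds a closer
neighbour (`exists_envelopeAdj_lt`). -/

/-! ### Consecutive pairs in a sweep -/

section Sweep

variable {ι : Type*}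

open Classical in
/-- The pairs of elements of `A` that are consecutive in the order given by the height `h`. -/
noncomputable def consecutivePairs (h : ι → ℝ) (A : Finset ι) : Finset (ι × ι) :=
  (A ×ˢ A).filter fun p => h p.1 < h p.2 ∧ ∀ x ∈ A, h p.1 < h x → h p.2 ≤ h x

theorem mem_consecutivePairs {h : ι → ℝ} {A : Finset ι} {u v : ι} :
    (u, v) ∈ consecutivePairs h A ↔
      u ∈ A ∧ v ∈ A ∧ h u < h v ∧ ∀ x ∈ A, h u < h x → h v ≤ h x := by
  simp [consecutivePairs, and_assoc]

/-- Distinct consecutive pairs span disjoint open intervals of heights; the injectivity claims of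
the counting below all reduce to this. -/
theorem consecutivePairs_eq_of_between {h : ι → ℝ} (hh : Function.Injective h) {A : Finset ι}
    {p q : ι × ι} (hp : p ∈ consecutivePairs h A) (hq : q ∈ consecutivePairs h A)
    (h1 : h p.1 < h q.2) (h2 : h q.1 < h p.2) : p = q := by
  obtain ⟨u, v⟩ := p
  obtain ⟨u', v'⟩ := q
  rw [mem_consecutivePairs] at hp hq
  obtain ⟨hu, hv, huv, H⟩ := hp
  obtain ⟨hu', hv', huv', H'⟩ := hq
  simp only at h1 h2
  have e1 : h v ≤ h v' := H v' hv' h1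
  have e2 : h v' ≤ h v := H' v hv h2
  have e3 : h u' ≤ h u := by
    by_contra hc
    have := H u' hu' (not_le.1 hc)
    linarith
  have e4 : h u ≤ h u' := by
    by_contra hc
    have := H' u hu (not_le.1 hc)
    linarith
  rw [hh (le_antisymm e1 e2), hh (le_antisymm e3 e4)]

theorem card_consecutivePairs_le {h : ι → ℝ} (hh : Function.Injective h) (A : Finset ι) :
    (consecutivePairs h A).card ≤ A.card := by
  refine Finset.card_le_card_of_injOn Prod.fst (fun p hp => ?_) (fun p hp q hq hpq => ?_)
  · exact (mem_consecutivePairs.1 (show (p.1, p.2) ∈ _ from hp)).1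
  · have hp2 := (mem_consecutivePairs.1 (show (p.1, p.2) ∈ _ from hp)).2.2.1
    have hq2 := (mem_consecutivePairs.1 (show (q.1, q.2) ∈ _ from hq)).2.2.1
    refine consecutivePairs_eq_of_between hh hp hq ?_ ?_
    · rw [hpq]; exact hq2
    · rw [← hpq]; exact hp2

/-- A new pair has an inserted lower end, an inserted upper end, or two old ends that a deleted
element used to separate. So an insertion pays for two pairs and a deletion for one. -/
theorem card_consecutivePairs_sdiff_le [DecidableEq ι] {h : ι → ℝ} (hh : Function.Injective h)
    (A B : Finset ι) :
    (consecutivePairs h B \ consecutivePairs h A).card ≤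
      2 * (B \ A).card + (A \ B).card := by
  classical
  set D := consecutivePairs h B \ consecutivePairs h A with hD
  have hDB : ∀ p ∈ D, p ∈ consecutivePairs h B := fun p hp => (Finset.mem_sdiff.1 hp).1
  have hlt : ∀ p ∈ D, h p.1 < h p.2 := fun p hp =>
    (mem_consecutivePairs.1 (show (p.1, p.2) ∈ _ from hDB p hp)).2.2.1
  have c1 : (D.filter fun p => p.1 ∉ A).card ≤ (B \ A).card := by
    refine Finset.card_le_card_of_injOn Prod.fst (fun p hp => ?_) (fun p hp q hq hpq => ?_)
    · obtain ⟨hp1, hp2⟩ := Finset.mem_filter.1 hp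
      exact Finset.mem_sdiff.2
        ⟨(mem_consecutivePairs.1 (show (p.1, p.2) ∈ _ from hDB p hp1)).1, hp2⟩
    · have hp1 := (Finset.mem_filter.1 hp).1
      have hq1 := (Finset.mem_filter.1 hq).1
      refine consecutivePairs_eq_of_between hh (hDB p hp1) (hDB q hq1) ?_ ?_
      · rw [hpq]; exact hlt q hq1
      · rw [← hpq]; exact hlt p hp1
  have c2 : (D.filter fun p => p.2 ∉ A).card ≤ (B \ A).card := by
    refine Finset.card_le_card_of_injOn Prod.snd (fun p hp => ?_) (fun p hp q hq hpq => ?_)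
    · obtain ⟨hp1, hp2⟩ := Finset.mem_filter.1 hp
      exact Finset.mem_sdiff.2
        ⟨(mem_consecutivePairs.1 (show (p.1, p.2) ∈ _ from hDB p hp1)).2.1, hp2⟩
    · have hp1 := (Finset.mem_filter.1 hp).1
      have hq1 := (Finset.mem_filter.1 hq).1
      refine consecutivePairs_eq_of_between hh (hDB p hp1) (hDB q hq1) ?_ ?_
      · rw [← hpq]; exact hlt p hp1
      · rw [hpq]; exact hlt q hq1
  have hbetween : ∀ p, ∃ x, p ∈ D.filter (fun p => p.1 ∈ A ∧ p.2 ∈ A) →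
      x ∈ A \ B ∧ h p.1 < h x ∧ h x < h p.2 := by
    intro p
    by_cases hp : p ∈ D.filter (fun p => p.1 ∈ A ∧ p.2 ∈ A)
    swap
    · exact ⟨p.1, fun hp' => absurd hp' hp⟩
    obtain ⟨hp1, hpA, hpA'⟩ := Finset.mem_filter.1 hp
    have hnot : (p.1, p.2) ∉ consecutivePairs h A := (Finset.mem_sdiff.1 hp1).2
    have hB := mem_consecutivePairs.1 (show (p.1, p.2) ∈ _ from hDB p hp1)
    rw [mem_consecutivePairs] at hnot
    push Not at hnot
    obtain ⟨x, hxA, hx1, hx2⟩ := hnot hpA hpA' hB.2.2.1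
    refine ⟨x, fun _ => ⟨Finset.mem_sdiff.2 ⟨hxA, fun hxB => ?_⟩, hx1, hx2⟩⟩
    exact absurd (hB.2.2.2 x hxB hx1) (not_le.2 hx2)
  have c3 : (D.filter fun p => p.1 ∈ A ∧ p.2 ∈ A).card ≤ (A \ B).card := by
    choose f hf using hbetween
    refine Finset.card_le_card_of_injOn f (fun p hp => (hf p hp).1) (fun p hp q hq hpq => ?_)
    have hp1 := (Finset.mem_filter.1 hp).1
    have hq1 := (Finset.mem_filter.1 hq).1
    refine consecutivePairs_eq_of_between hh (hDB p hp1) (hDB q hq1) ?_ ?_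
    · exact (hf p hp).2.1.trans (by rw [hpq]; exact (hf q hq).2.2)
    · exact (hf q hq).2.1.trans (by rw [← hpq]; exact (hf p hp).2.2)
  have hcover : D ⊆ (D.filter fun p => p.1 ∉ A) ∪ (D.filter fun p => p.2 ∉ A) ∪
      (D.filter fun p => p.1 ∈ A ∧ p.2 ∈ A) := by
    intro p hp
    simp only [Finset.mem_union, Finset.mem_filter]
    tauto
  have := Finset.card_le_card hcover
  have h1 := Finset.card_union_le ((D.filter fun p => p.1 ∉ A) ∪ (D.filter fun p => p.2 ∉ A))
    (D.filter fun p => p.1 ∈ A ∧ p.2 ∈ A)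
  have h2 := Finset.card_union_le (D.filter fun p => p.1 ∉ A) (D.filter fun p => p.2 ∉ A)
  omega

/-- If every element is present during an interval of times, then the number of pairs that are
consecutive at some time is at most three times the number of elements. -/
theorem card_biUnion_consecutivePairs_le [DecidableEq ι] {h : ι → ℝ} (hh : Function.Injective h)
    (A : ℝ → Finset ι)
    (hA : ∀ r s t : ℝ, r ≤ s → s ≤ t → ∀ x ∈ A r, x ∈ A t → x ∈ A s) (T : Finset ℝ) :
    ∀ τ ∈ T, (∀ t ∈ T, t ≤ τ) →
      (T.biUnion fun t => consecutivePairs h (A t)).card + (A τ).card ≤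
        3 * (T.biUnion A).card := by
  classical
  -- The summand `(A τ).card` is a potential: i insertions and d deletions create at most 2i + d
  -- pairs and change it by i - d, so the left side grows by at most 3i.
  induction T using Finset.induction_on_max with
  | empty => simp
  | insert τ T hT ih =>
    intro τ' hτ' hmax
    obtain rfl : τ' = τ := by
      rcases Finset.mem_insert.1 hτ' with h1 | h1
      · exact h1
      · exact absurd (hmax τ (Finset.mem_insert_self _ _)) (not_le.2 (hT _ h1))
    rw [Finset.biUnion_insert, Finset.biUnion_insert]
    rcases T.eq_empty_or_nonempty with rfl | hne
    · have := card_consecutivePairs_le hh (A τ')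
      simp only [Finset.biUnion_empty, Finset.union_empty]
      omega
    · set σ := T.max' hne with hσ
      have hσT : σ ∈ T := Finset.max'_mem _ _
      have ih' := ih σ hσT (fun t ht => Finset.le_max' _ _ ht)
      have hstep := card_consecutivePairs_sdiff_le hh (A σ) (A τ')
      have hpairs : (consecutivePairs h (A τ') ∪
          T.biUnion fun t => consecutivePairs h (A t)).card ≤
          (consecutivePairs h (A τ') \ consecutivePairs h (A σ)).card +
            (T.biUnion fun t => consecutivePairs h (A t)).card := by
        refine le_trans (Finset.card_le_card ?_) (Finset.card_union_le _ _)
        intro p hp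
        rcases Finset.mem_union.1 hp with h1 | h1
        · by_cases h2 : p ∈ consecutivePairs h (A σ)
          · exact Finset.mem_union_right _ (Finset.mem_biUnion.2 ⟨σ, hσT, h2⟩)
          · exact Finset.mem_union_left _ (Finset.mem_sdiff.2 ⟨h1, h2⟩)
        · exact Finset.mem_union_right _ h1
      -- By the interval hypothesis an inserted element was never present before, so it is charged
      -- only once.
      have hdisj : Disjoint (A τ' \ A σ) (T.biUnion A) := by
        rw [Finset.disjoint_left]
        intro x hx hx'
        obtain ⟨t, ht, hxt⟩ := Finset.mem_biUnion.1 hx'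
        obtain ⟨hx1, hx2⟩ := Finset.mem_sdiff.1 hx
        exact hx2 (hA t σ τ' (Finset.le_max' _ _ ht) (hT _ hσT).le x hxt hx1)
      have hsites : (A τ' \ A σ).card + (T.biUnion A).card ≤ (A τ' ∪ T.biUnion A).card := by
        rw [← Finset.card_union_of_disjoint hdisj]
        refine Finset.card_le_card (Finset.union_subset_union_left Finset.sdiff_subset)
      have e1 := Finset.card_sdiff_add_card_inter (A τ') (A σ)
      have e2 := Finset.card_sdiff_add_card_inter (A σ) (A τ')
      rw [Finset.inter_comm] at e2
      omega

end Sweep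

/-! ### Lower envelopes of planar affine functions -/

section Envelope

open Filter Topology

variable {ι : Type*}

/-- The affine function of the site `x`, with coefficients `c x`, `b x` and `h x`. -/
def siteValue (c b h : ι → ℝ) (x : ι) (X s : ℝ) : ℝ := c x + b x * X + h x * s

open Classical in
/-- The sites of `W` that are the strict minimum somewhere on the line of abscissa `X`. -/
noncomputable def sitesOnLine (c b h : ι → ℝ) (W : Finset ι) (X : ℝ) : Finset ι :=
  W.filter fun x => ∃ s, ∀ y ∈ W, y ≠ x → siteValue c b h x X s < siteValue c b h y X s

theorem mem_sitesOnLine {c b h : ι → ℝ} {W : Finset ι} {X : ℝ} {x : ι} :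
    x ∈ sitesOnLine c b h W X ↔
      x ∈ W ∧ ∃ s, ∀ y ∈ W, y ≠ x → siteValue c b h x X s < siteValue c b h y X s := by
  simp [sitesOnLine]

/-- Two sites are neighbours if at some point exactly these two attain the minimum over `W`. -/
def EnvelopeAdj (c b h : ι → ℝ) (W : Finset ι) (u v : ι) : Prop :=
  ∃ X s, siteValue c b h u X s = siteValue c b h v X s ∧
    ∀ x ∈ W, x ≠ u → x ≠ v → siteValue c b h u X s < siteValue c b h x X s

theorem EnvelopeAdj.symm {c b h : ι → ℝ} {W : Finset ι} {u v : ι}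
    (H : EnvelopeAdj c b h W u v) : EnvelopeAdj c b h W v u := by
  obtain ⟨X, s, h1, h2⟩ := H
  exact ⟨X, s, h1.symm, fun x hx hxv hxu => h1 ▸ h2 x hx hxu hxv⟩

theorem mem_sitesOnLine_of_between (c b h : ι → ℝ) (W : Finset ι) (X₁ X X₂ : ℝ)
    (h1 : X₁ ≤ X) (h2 : X ≤ X₂) (x : ι) (hx1 : x ∈ sitesOnLine c b h W X₁)
    (hx2 : x ∈ sitesOnLine c b h W X₂) : x ∈ sitesOnLine c b h W X := by
  obtain ⟨hxW, s₁, H1⟩ := mem_sitesOnLine.1 hx1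
  obtain ⟨-, s₂, H2⟩ := mem_sitesOnLine.1 hx2
  obtain ⟨α, β, hα, hβ, hαβ, hX⟩ : X ∈ segment ℝ X₁ X₂ := by
    rw [segment_eq_Icc (h1.trans h2)]; exact ⟨h1, h2⟩
  refine mem_sitesOnLine.2 ⟨hxW, α * s₁ + β * s₂, fun y hy hyx => ?_⟩
  have e1 := H1 y hy hyx
  have e2 := H2 y hy hyx
  have key : ∀ z, siteValue c b h z X (α * s₁ + β * s₂) =
      α * siteValue c b h z X₁ s₁ + β * siteValue c b h z X₂ s₂ := by
    intro z
    simp only [siteValue, ← hX, smul_eq_mul]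
    linear_combination (-c z) * hαβ
  rw [key, key]
  rcases hα.eq_or_lt with h0 | h0
  · have : β = 1 := by linarith
    subst this
    rw [← h0]
    linarith
  · nlinarith [mul_lt_mul_of_pos_left e1 h0, mul_le_mul_of_nonneg_left e2.le hβ]

/-- Along the line, `h` is the slope in `s`. Just above the tie the smaller slope `u` wins, just
below it `v` wins. A site of intermediate slope lies strictly above the tie, so it stays above `u`
on one side and above `v` on the other. -/
theorem mem_consecutivePairs_of_envelopeAdj {c b h : ι → ℝ} {W : Finset ι} {u v : ι} {X s : ℝ}
    (hu : u ∈ W) (hv : v ∈ W) (huv : h u < h v)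
    (h1 : siteValue c b h u X s = siteValue c b h v X s)
    (h2 : ∀ x ∈ W, x ≠ u → x ≠ v → siteValue c b h u X s < siteValue c b h x X s) :
    (u, v) ∈ consecutivePairs h (sitesOnLine c b h W X) := by
  have shift : ∀ z δ, siteValue c b h z X (s + δ) = siteValue c b h z X s + h z * δ := by
    intro z δ
    simp only [siteValue]
    ring
  have near : ∀ x w, siteValue c b h w X s < siteValue c b h x X s → ∀ᶠ δ in 𝓝 (0 : ℝ),
      siteValue c b h w X (s + δ) < siteValue c b h x X (s + δ) := by
    intro x w hlt
    have hc : ∀ z, Continuous fun δ : ℝ => siteValue c b h z X (s + δ) := by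
      intro z
      simp only [siteValue]
      fun_prop
    refine (hc w).continuousAt.eventually_lt (hc x).continuousAt ?_
    simpa using hlt
  rw [mem_consecutivePairs]
  refine ⟨?_, ?_, huv, ?_⟩
  · have : ∀ᶠ δ in 𝓝[>] (0 : ℝ), ∀ y ∈ W, y ≠ u →
        siteValue c b h u X (s + δ) < siteValue c b h y X (s + δ) := by
      rw [Filter.eventually_all_finset]
      intro y hy
      by_cases hyv : y = v
      · filter_upwards [self_mem_nhdsWithin] with δ hδ _
        rw [hyv, shift, shift, h1]
        have : h u * δ < h v * δ := mul_lt_mul_of_pos_right huv hδ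
        linarith
      · by_cases hyu : y = u
        · exact Eventually.of_forall fun _ hne => absurd hyu hne
        · filter_upwards [nhdsWithin_le_nhds (near y u (h2 y hy hyu hyv))] with δ hδ _ using hδ
    obtain ⟨δ, hδ⟩ := this.exists
    exact mem_sitesOnLine.2 ⟨hu, s + δ, hδ⟩
  · have : ∀ᶠ δ in 𝓝[<] (0 : ℝ), ∀ y ∈ W, y ≠ v →
        siteValue c b h v X (s + δ) < siteValue c b h y X (s + δ) := by
      rw [Filter.eventually_all_finset]
      intro y hy
      by_cases hyu : y = u
      · filter_upwards [self_mem_nhdsWithin] with δ hδ _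
        rw [hyu, shift, shift, h1]
        have : h v * δ < h u * δ := mul_lt_mul_of_neg_right huv hδ
        linarith
      · by_cases hyv : y = v
        · exact Eventually.of_forall fun _ hne => absurd hyv hne
        · filter_upwards [nhdsWithin_le_nhds (near y v (h1 ▸ h2 y hy hyu hyv))] with δ hδ _
            using hδ
    obtain ⟨δ, hδ⟩ := this.exists
    exact mem_sitesOnLine.2 ⟨hv, s + δ, hδ⟩
  · intro x hx hux
    by_contra hxv
    rw [not_le] at hxv
    obtain ⟨hxW, s', H⟩ := mem_sitesOnLine.1 hx
    have hxu : x ≠ u := fun e => by rw [e] at hux; exact lt_irrefl _ hux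
    have hxv' : x ≠ v := fun e => by rw [e] at hxv; exact lt_irrefl _ hxv
    have e0 := h2 x hxW hxu hxv'
    have e1 := H u hu hxu.symm
    have e2 := H v hv hxv'.symm
    obtain ⟨δ, rfl⟩ : ∃ δ, s' = s + δ := ⟨s' - s, by ring⟩
    rw [shift, shift] at e1 e2
    rcases le_total 0 δ with hδ | hδ
    · have := mul_le_mul_of_nonneg_right hux.le hδ
      linarith
    · have := mul_le_mul_of_nonpos_right hxv.le hδ
      linarith

-- One abscissa per adjacent pair is swept. Strictness comes from the potential, which is still
-- positive at the last abscissa.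
open Classical in
theorem card_envelopeAdj_lt (c b : ι → ℝ) {h : ι → ℝ} (hh : Function.Injective h)
    {W : Finset ι} (hW : W.Nonempty) :
    ((W ×ˢ W).filter fun p => h p.1 < h p.2 ∧ EnvelopeAdj c b h W p.1 p.2).card <
      3 * W.card := by
  set S := (W ×ˢ W).filter fun p => h p.1 < h p.2 ∧ EnvelopeAdj c b h W p.1 p.2 with hS
  rcases S.eq_empty_or_nonempty with h0 | hne
  · rw [h0]
    simpa using hW
  have hwit : ∀ p, ∃ X, p ∈ S → p ∈ consecutivePairs h (sitesOnLine c b h W X) := by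
    intro p
    by_cases hp : p ∈ S
    · obtain ⟨hpW, hlt, X, s, h1, h2⟩ := Finset.mem_filter.1 hp
      obtain ⟨hu, hv⟩ := Finset.mem_product.1 hpW
      exact ⟨X, fun _ => mem_consecutivePairs_of_envelopeAdj hu hv hlt h1 h2⟩
    · exact ⟨0, fun hp' => absurd hp' hp⟩
  choose X hX using hwit
  set T := S.image X with hT
  have hTne : T.Nonempty := hne.image X
  have hmax := Finset.max'_mem T hTne
  have hcount := card_biUnion_consecutivePairs_le hh (sitesOnLine c b h W)
    (fun r s t hrs hst x hxr hxt => mem_sitesOnLine_of_between c b h W r s t hrs hst x hxr hxt)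
    T (T.max' hTne) hmax (fun t ht => Finset.le_max' _ _ ht)
  have c1 : S.card ≤ (T.biUnion fun t => consecutivePairs h (sitesOnLine c b h W t)).card :=
    Finset.card_le_card fun p hp =>
      Finset.mem_biUnion.2 ⟨X p, Finset.mem_image_of_mem X hp, hX p hp⟩
  have c2 : (T.biUnion (sitesOnLine c b h W)).card ≤ W.card :=
    Finset.card_le_card (Finset.biUnion_subset.2 fun t _ => Finset.filter_subset _ _)
  have c3 : 0 < (sitesOnLine c b h W (T.max' hTne)).card := by
    obtain ⟨p, hp, hpX⟩ := Finset.mem_image.1 hmax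
    refine Finset.card_pos.2 ⟨p.1, ?_⟩
    have := hX p hp
    rw [hpX] at this
    exact (mem_consecutivePairs.1 (show (p.1, p.2) ∈ _ from this)).1
  omega

/-- Meant for an affine function restricted to a parabola, which vanishes identically only if the
function does. -/
theorem eventually_quadratic_ne_zero {p q r : ℝ} (H : ¬ (p = 0 ∧ q = 0 ∧ r = 0)) :
    ∀ᶠ ε in 𝓝[>] (0 : ℝ), p + q * ε + r * ε ^ 2 ≠ 0 := by
  by_cases hp : p = 0
  · by_cases hq : q = 0
    · have hr : r ≠ 0 := fun hr => H ⟨hp, hq, hr⟩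
      filter_upwards [self_mem_nhdsWithin] with ε hε
      have : ε ≠ 0 := (show (0 : ℝ) < ε from hε).ne'
      simp [hp, hq, hr, this]
    · have hc : ContinuousAt (fun ε : ℝ => q + r * ε) 0 := by fun_prop
      have : ∀ᶠ ε in 𝓝 (0 : ℝ), q + r * ε ≠ 0 := hc.eventually_ne (by simpa using hq)
      filter_upwards [self_mem_nhdsWithin, nhdsWithin_le_nhds this] with ε hε h1
      have h0 : ε ≠ 0 := (show (0 : ℝ) < ε from hε).ne'
      have : p + q * ε + r * ε ^ 2 = ε * (q + r * ε) := by rw [hp]; ring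
      rw [this]
      exact mul_ne_zero h0 h1
  · have hc : ContinuousAt (fun ε : ℝ => p + q * ε + r * ε ^ 2) 0 := by fun_prop
    exact nhdsWithin_le_nhds (hc.eventually_ne (by simpa using hp))

/-- If `u` is the strict minimum somewhere, then wherever `u` is not a minimum, some neighbour
of `u` has a smaller value. -/
theorem exists_envelopeAdj_lt {c b h : ι → ℝ} {W : Finset ι} {u : ι} {X₀ s₀ : ℝ}
    (hmin : ∀ x ∈ W, x ≠ u → siteValue c b h u X₀ s₀ < siteValue c b h x X₀ s₀)
    (hgen : ∀ x ∈ W, ∀ y ∈ W, x ≠ u → y ≠ u → ∀ l : ℝ, c x - c u = l * (c y - c u) →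
      b x - b u = l * (b y - b u) → h x - h u = l * (h y - h u) → x = y)
    {X s : ℝ} {w : ι} (hw : w ∈ W) (hwu : siteValue c b h w X s < siteValue c b h u X s) :
    ∃ v ∈ W, v ≠ u ∧ EnvelopeAdj c b h W u v ∧
      siteValue c b h v X s < siteValue c b h u X s := by
  classical
  -- The excess over `u` is positive for every other site near `(X₀, s₀)`. Along a segment from
  -- there to `(X, s)`, the first site whose excess vanishes is the wanted neighbour.
  set f : ι → ℝ → ℝ → ℝ := fun x X s => siteValue c b h x X s - siteValue c b h u X s with hf
  set T := W.filter fun x => f x X s < 0 with hT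
  have hTu : ∀ x ∈ T, x ≠ u := by
    intro x hx e
    have := (Finset.mem_filter.1 hx).2
    simp [hf, e] at this
  have hTW : ∀ x ∈ T, x ∈ W := fun x hx => (Finset.mem_filter.1 hx).1
  have hTneg : ∀ x ∈ T, f x X s < 0 := fun x hx => (Finset.mem_filter.1 hx).2
  have hpos : ∀ᶠ ε in 𝓝[>] (0 : ℝ), ∀ x ∈ W, x ≠ u → 0 < f x (X₀ + ε) (s₀ + ε ^ 2) := by
    rw [Filter.eventually_all_finset]
    intro x hx
    by_cases hxu : x = u
    · exact Eventually.of_forall fun _ hne => absurd hxu hne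
    · have hc : ContinuousAt (fun ε : ℝ => f x (X₀ + ε) (s₀ + ε ^ 2)) 0 := by
        simp only [hf, siteValue]
        fun_prop
      have h0 : 0 < f x (X₀ + 0) (s₀ + 0 ^ 2) := by
        have := hmin x hx hxu
        simp only [hf]
        simpa using this
      filter_upwards [nhdsWithin_le_nhds (hc.eventually_const_lt h0)] with ε hε _ using hε
  -- Moving the start along a parabola excludes simultaneous crossings: a tie is the zero of an
  -- affine function that `hgen` keeps from vanishing identically.
  have hne : ∀ᶠ ε in 𝓝[>] (0 : ℝ), ∀ x ∈ T, ∀ y ∈ T, x ≠ y →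
      f y X s * f x (X₀ + ε) (s₀ + ε ^ 2) ≠ f x X s * f y (X₀ + ε) (s₀ + ε ^ 2) := by
    rw [Filter.eventually_all_finset]
    intro x hx
    rw [Filter.eventually_all_finset]
    intro y hy
    by_cases hxy : x = y
    · exact Eventually.of_forall fun _ hne => absurd hxy hne
    set B := f y X s * (b x - b u) - f x X s * (b y - b u) with hB
    set K := f y X s * (h x - h u) - f x X s * (h y - h u) with hK
    set C := f y X s * (c x - c u) - f x X s * (c y - c u) with hC
    have hyn := (hTneg y hy).ne
    have H : ¬ (C + B * X₀ + K * s₀ = 0 ∧ B = 0 ∧ K = 0) := by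
      rintro ⟨h1, h2, h3⟩
      have h1' : C = 0 := by rw [h2, h3] at h1; linarith
      refine hxy (hgen x (hTW x hx) y (hTW y hy) (hTu x hx) (hTu y hy) (f x X s / f y X s)
        ?_ ?_ ?_)
      · field_simp
        linarith
      · field_simp
        linarith
      · field_simp
        linarith
    filter_upwards [eventually_quadratic_ne_zero H] with ε hε _ heq
    apply hε
    have : C + B * X₀ + K * s₀ + B * ε + K * ε ^ 2 =
        f y X s * f x (X₀ + ε) (s₀ + ε ^ 2) - f x X s * f y (X₀ + ε) (s₀ + ε ^ 2) := by
      rw [hB, hK, hC]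
      simp only [hf, siteValue]
      ring
    rw [this, heq, sub_self]
  obtain ⟨ε, hε1, hε2⟩ := (hpos.and hne).exists
  set X₁ := X₀ + ε
  set s₁ := s₀ + ε ^ 2
  -- `l x` is the parameter on the segment at which the excess of `x` vanishes.
  set l : ι → ℝ := fun x => f x X₁ s₁ / (f x X₁ s₁ - f x X s) with hl
  have hwT : w ∈ T := Finset.mem_filter.2 ⟨hw, by simp only [hf]; linarith⟩
  obtain ⟨v, hvT, hv⟩ := Finset.exists_min_image T l ⟨w, hwT⟩
  have hv1 := hε1 v (hTW v hvT) (hTu v hvT)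
  have hv2 := hTneg v hvT
  have hl0 : 0 < l v := div_pos hv1 (by linarith)
  have hl1 : l v < 1 := by
    rw [hl]
    simp only
    rw [div_lt_one (by linarith)]
    linarith
  have hcomb : ∀ x, f x (X₁ + l v * (X - X₁)) (s₁ + l v * (s - s₁)) =
      (1 - l v) * f x X₁ s₁ + l v * f x X s := by
    intro x
    simp only [hf, siteValue]
    ring
  refine ⟨v, hTW v hvT, hTu v hvT, ⟨X₁ + l v * (X - X₁), s₁ + l v * (s - s₁), ?_, ?_⟩, ?_⟩
  · have := hcomb v
    have h0 : (1 - l v) * f v X₁ s₁ + l v * f v X s = 0 := by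
      have hd : f v X₁ s₁ - f v X s ≠ 0 := by linarith
      simp only [hl]
      field_simp
      ring
    rw [h0] at this
    simp only [hf] at this
    linarith
  · intro x hxW hxu hxv
    have hx1 := hε1 x hxW hxu
    suffices 0 < f x (X₁ + l v * (X - X₁)) (s₁ + l v * (s - s₁)) by
      simp only [hf] at this
      linarith
    rw [hcomb]
    by_cases hxT : x ∈ T
    · have hx2 := hTneg x hxT
      have hlt : l v < l x := by
        refine lt_of_le_of_ne (hv x hxT) fun e => ?_
        apply hε2 x hxT v hvT hxv
        simp only [hl] at e
        rw [div_eq_div_iff (by linarith) (by linarith)] at e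
        linarith
      simp only [hl] at hlt
      rw [lt_div_iff₀ (by linarith)] at hlt
      simp only [hl]
      linarith
    · have hx2 : 0 ≤ f x X s := by
        by_contra hc
        exact hxT (Finset.mem_filter.2 ⟨hxW, not_le.1 hc⟩)
      have := mul_pos (sub_pos.2 hl1) hx1
      have := mul_nonneg hl0.le hx2
      linarith
  · have := hv2
    simp only [hf] at this
    linarith

end Envelope

/-! ### A sparse graph that serves a planar point set -/

section Planar

variable {ι : Type*}

/-- Each pair with different `b`-values excludes a single κ. -/
theorem exists_injective_add_mul [Finite ι] (a b : ι → ℝ)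
    (hab : ∀ x y, a x = a y → b x = b y → x = y) :
    ∃ κ : ℝ, Function.Injective fun x => a x + κ * b x := by
  have hfin : (Set.range fun p : ι × ι => (a p.1 - a p.2) / (b p.2 - b p.1)).Finite :=
    Set.finite_range _
  obtain ⟨κ, hκ⟩ := hfin.infinite_compl.nonempty
  refine ⟨κ, fun x y hxy => ?_⟩
  simp only at hxy
  by_cases hb : b x = b y
  · rw [hb] at hxy
    exact hab x y (by linarith) hb
  · refine absurd ⟨(x, y), ?_⟩ hκ
    have : b y - b x ≠ 0 := fun e => hb (by linarith)
    simp only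
    field_simp
    linarith

/-- A finite set of `n` points in the plane carries a graph with fewer than `3 n` edges such that
every point that is not closest to a target has a neighbour that is closer to the target. -/
theorem exists_sparse_serving_graph [Finite ι] {p : ι → EuclideanSpace ℝ (Fin 2)}
    (hp : Function.Injective p) {W : Finset ι} (hW : W.Nonempty) :
    ∃ T : ι → Finset ι, ∑ u ∈ W, (T u).card < 3 * W.card ∧
      ∀ u ∈ W, ∀ t : EuclideanSpace ℝ (Fin 2), (∃ w ∈ W, dist (p w) t < dist (p u) t) →
        ∃ x ∈ W, (x ∈ T u ∨ u ∈ T x) ∧ dist (p x) t < dist (p u) t := by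
  classical
  obtain ⟨κ, hκ⟩ := exists_injective_add_mul (fun x => p x 0) (fun x => p x 1) (by
    intro x y h0 h1
    refine hp ?_
    ext i
    fin_cases i
    · exact h0
    · exact h1)
  -- In the sheared coordinates X = t₁ - κ t₀, s = t₀, the site value is |p|² - 2⟨p, t⟩; the shear
  -- makes the slopes `h` distinct.
  set h : ι → ℝ := fun x => -2 * (p x 0 + κ * p x 1) with hh
  set b : ι → ℝ := fun x => -2 * p x 1 with hb
  set c : ι → ℝ := fun x => p x 0 ^ 2 + p x 1 ^ 2 with hc
  have hinj : Function.Injective h := fun x y hxy => hκ (by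
    simp only [hh] at hxy ⊢
    linarith)
  have hdist : ∀ x y : ι, ∀ t : EuclideanSpace ℝ (Fin 2), dist (p x) t < dist (p y) t ↔
      siteValue c b h x (t 1 - κ * t 0) (t 0) < siteValue c b h y (t 1 - κ * t 0) (t 0) := by
    intro x y t
    have key : ∀ z, dist (p z) t ^ 2 =
        siteValue c b h z (t 1 - κ * t 0) (t 0) + (t 0 ^ 2 + t 1 ^ 2) := by
      intro z
      rw [EuclideanSpace.dist_sq_eq, Fin.sum_univ_two, Real.dist_eq, Real.dist_eq, sq_abs, sq_abs]
      simp only [siteValue, hh, hb, hc]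
      ring
    rw [← sq_lt_sq₀ dist_nonneg dist_nonneg, key, key, add_lt_add_iff_right]
  refine ⟨fun u => W.filter fun v => h u < h v ∧ EnvelopeAdj c b h W u v, ?_, ?_⟩
  · refine lt_of_eq_of_lt ?_ (card_envelopeAdj_lt c b hinj hW)
    rw [← Finset.card_sigma]
    refine Finset.card_bij' (fun q _ => (q.1, q.2)) (fun q _ => ⟨q.1, q.2⟩) ?_ ?_ ?_ ?_
    · rintro ⟨x, y⟩ hq
      simpa [and_assoc] using hq
    · rintro ⟨x, y⟩ hq
      simpa [and_assoc] using hq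
    · intro q _; rfl
    · intro q _; rfl
  · rintro u hu t ⟨w, hw, hwt⟩
    have hmin : ∀ x ∈ W, x ≠ u → siteValue c b h u (p u 1 - κ * p u 0) (p u 0) <
        siteValue c b h x (p u 1 - κ * p u 0) (p u 0) := by
      intro x _ hxu
      rw [← hdist, dist_self]
      exact dist_pos.2 (hp.ne hxu)
    obtain ⟨v, hvW, hvu, hadj, hlt⟩ := exists_envelopeAdj_lt hmin (by
      intro x _ y _ hxu hyu l hl1 hl2 hl3
      simp only [hh, hb, hc] at hl1 hl2 hl3
      have e1 : p x 1 - p u 1 = l * (p y 1 - p u 1) := by linarith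
      have e0 : p x 0 - p u 0 = l * (p y 0 - p u 0) := by linear_combination -hl3 / 2 - κ * e1
      have e0' : p x 0 = p u 0 + l * (p y 0 - p u 0) := by linarith
      have e1' : p x 1 = p u 1 + l * (p y 1 - p u 1) := by linarith
      rw [e0', e1'] at hl1
      -- The lifted points (p, |p|²) of `u`, `x`, `y` would be collinear, but a line meets the
      -- paraboloid at most twice.
      have hprod : l * (l - 1) * ((p y 0 - p u 0) ^ 2 + (p y 1 - p u 1) ^ 2) = 0 := by
        linear_combination hl1
      have eq_of : ∀ z w : ι, p z 0 = p w 0 → p z 1 = p w 1 → z = w := by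
        intro z w h0 h1
        refine hp ?_
        ext i
        fin_cases i
        · exact h0
        · exact h1
      rcases mul_eq_zero.1 hprod with h1 | h1
      · rcases mul_eq_zero.1 h1 with h2 | h2
        · rw [h2] at e0' e1'
          exact absurd (eq_of x u (by linarith) (by linarith)) hxu
        · have : l = 1 := by linarith
          rw [this] at e0' e1'
          exact eq_of x y (by linarith) (by linarith)
      · have h2 := sq_nonneg (p y 0 - p u 0)
        have h3 := sq_nonneg (p y 1 - p u 1)
        have h4 : (p y 0 - p u 0) ^ 2 = 0 := by linarith
        have h5 : (p y 1 - p u 1) ^ 2 = 0 := by linarith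
        rw [sq_eq_zero_iff] at h4 h5
        exact absurd (eq_of y u (by linarith) (by linarith)) hyu) hw ((hdist w u t).1 hwt)
    refine ⟨v, hvW, ?_, (hdist v u t).2 hlt⟩
    rcases lt_or_gt_of_ne (hinj.ne hvu) with h1 | h1
    · exact Or.inr (Finset.mem_filter.2 ⟨hu, h1, hadj.symm⟩)
    · exact Or.inl (Finset.mem_filter.2 ⟨hvW, h1, hadj⟩)

end Planar

/-! ### Greedy routing and social optima -/

namespace GreedyGame

section Game

variable {V : Type*} [MetricSpace V]

/-- For every target other than `u`, some point satisfying `N` is closer to it than `u`. -/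
def Covers (u : V) (N : V → Prop) : Prop :=
  ∀ t, t ≠ u → ∃ x, N x ∧ dist x t < dist u t

theorem Covers.mono {u : V} {N N' : V → Prop} (hN : Covers u N) (h : ∀ x, N x → N' x) :
    Covers u N' := fun t ht =>
  let ⟨x, hx, hlt⟩ := hN t ht
  ⟨x, h x hx, hlt⟩

/-- Only the first hop is retained, a condition on the neighbours of `u` alone. -/
theorem covers_of_greedyConnected {G : SimpleGraph V} {u : V} (h : GreedyConnected G u) :
    Covers u (G.Adj u) := by
  intro t ht
  obtain ⟨w, hw⟩ := h t ht
  cases w with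
  | nil => exact absurd rfl ht
  | cons hadj q =>
    rename_i x
    refine ⟨x, hadj, ?_⟩
    rw [IsGreedyPath, SimpleGraph.Walk.support_cons, ← SimpleGraph.Walk.cons_tail_support,
      List.isChain_cons_cons] at hw
    exact hw.1

theorem greedyConnected_of_covers [Finite V] {G : SimpleGraph V}
    (h : ∀ u, Covers u (G.Adj u)) (u : V) : GreedyConnected G u := by
  intro v huv
  clear huv
  have hwf : WellFounded fun x y : V => dist x v < dist y v := by
    have : IsTrans V fun x y : V => dist x v < dist y v := ⟨fun _ _ _ => lt_trans⟩
    have : Std.Irrefl fun x y : V => dist x v < dist y v := ⟨fun _ => lt_irrefl _⟩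
    exact Finite.wellFounded_of_trans_of_irrefl _
  induction u using hwf.induction with
  | _ u ih =>
    by_cases huv : v = u
    · subst huv
      exact ⟨SimpleGraph.Walk.nil, by simp [IsGreedyPath]⟩
    · obtain ⟨x, hadj, hlt⟩ := h u v huv
      obtain ⟨q, hq⟩ := ih x hlt
      refine ⟨SimpleGraph.Walk.cons hadj q, ?_⟩
      rw [IsGreedyPath, ← SimpleGraph.Walk.cons_tail_support] at hq
      rw [IsGreedyPath, SimpleGraph.Walk.support_cons, ← SimpleGraph.Walk.cons_tail_support,
        List.isChain_cons_cons]
      exact ⟨hlt, hq⟩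

theorem cost_of_greedyConnected {s : Profile V} {u : V} (h : GreedyConnected (network s) u) :
    cost s u = ((s u).1.card : ℕ∞) := by
  simp [cost, h]

theorem cost_of_not_greedyConnected {s : Profile V} {u : V}
    (h : ¬ GreedyConnected (network s) u) : cost s u = ⊤ := by
  simp [cost, h]

theorem socialCost_of_covers [Fintype V] {s : Profile V}
    (h : ∀ u, Covers u ((network s).Adj u)) :
    socialCost s = ((∑ u, (s u).1.card : ℕ) : ℕ∞) := by
  rw [socialCost, Nat.cast_sum]
  exact Finset.sum_congr rfl fun u _ => cost_of_greedyConnected (greedyConnected_of_covers h u)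

/-- The complete network has finite social cost. -/
theorem greedyConnected_of_optimal [Fintype V] {s : Profile V}
    (hs : ∀ s' : Profile V, socialCost s ≤ socialCost s') (u : V) :
    GreedyConnected (network s) u := by
  classical
  set s' : Profile V := fun u => ⟨Finset.univ.erase u, Finset.notMem_erase u _⟩ with hs'
  have hc : ∀ u, Covers u ((network s').Adj u) := by
    intro u t ht
    refine ⟨t, Or.inl ?_, ?_⟩
    · simp [hs', ht]
    · rw [dist_self]
      exact dist_pos.2 ht.symm
  by_contra hu
  have h1 := hs s'
  rw [socialCost_of_covers hc] at h1
  have h2 : cost s u ≤ socialCost s :=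
    Finset.single_le_sum (f := cost s) (fun _ _ => zero_le) (Finset.mem_univ u)
  rw [cost_of_not_greedyConnected hu] at h2
  exact absurd (h2.trans h1) (not_le.2 (ENat.natCast_lt_top _))

/-- Replacing the edges inside `W` of an optimal profile by other purchases of the agents in `W`
that keep these agents covered cannot save edges. -/
theorem sum_card_inter_le_of_optimal [Fintype V] [DecidableEq V] {s : Profile V}
    (hs : ∀ s' : Profile V, socialCost s ≤ socialCost s') (W : Finset V) (T : V → Finset V)
    (hT : ∀ u ∈ W, Covers u fun x =>
      ((network s).Adj u x ∧ x ∉ W) ∨ x ∈ T u ∨ (x ∈ W ∧ u ∈ T x)) :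
    ∑ u ∈ W, ((s u).1 ∩ W).card ≤ ∑ u ∈ W, (T u).card := by
  have hcov := fun u => covers_of_greedyConnected (greedyConnected_of_optimal hs u)
  -- Agents of `W` keep their purchases leaving `W`, so every edge between `W` and its complement
  -- survives, whoever bought it.
  set s' : Profile V := fun u =>
    ⟨(if u ∈ W then ((s u).1 \ W) ∪ T u else (s u).1).erase u, Finset.notMem_erase u _⟩ with hs'
  have hmem : ∀ u x, x ∈ (s' u).1 ↔
      x ≠ u ∧ x ∈ (if u ∈ W then ((s u).1 \ W) ∪ T u else (s u).1) := by
    intro u x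
    simp [hs']
  have hcov' : ∀ u, Covers u ((network s').Adj u) := by
    intro u t ht
    by_cases hu : u ∈ W
    · obtain ⟨x, hx, hlt⟩ := hT u hu t ht
      have hxu : x ≠ u := fun e => by rw [e] at hlt; exact lt_irrefl _ hlt
      refine ⟨x, ?_, hlt⟩
      rcases hx with ⟨hx | hx, hxW⟩ | hx | ⟨hxW, hx⟩
      · left
        rw [hmem, if_pos hu]
        exact ⟨hxu, Finset.mem_union_left _ (Finset.mem_sdiff.2 ⟨hx, hxW⟩)⟩
      · right
        rw [hmem, if_neg hxW]
        exact ⟨hxu.symm, hx⟩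
      · left
        rw [hmem, if_pos hu]
        exact ⟨hxu, Finset.mem_union_right _ hx⟩
      · right
        rw [hmem, if_pos hxW]
        exact ⟨hxu.symm, Finset.mem_union_right _ hx⟩
    · obtain ⟨x, hx, hlt⟩ := hcov u t ht
      have hxu : x ≠ u := fun e => by rw [e] at hlt; exact lt_irrefl _ hlt
      refine ⟨x, ?_, hlt⟩
      rcases hx with hx | hx
      · left
        rw [hmem, if_neg hu]
        exact ⟨hxu, hx⟩
      · right
        rw [hmem]
        refine ⟨hxu.symm, ?_⟩
        split_ifs
        · exact Finset.mem_union_left _ (Finset.mem_sdiff.2 ⟨hx, hu⟩)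
        · exact hx
  have h1 := hs s'
  rw [socialCost_of_covers hcov, socialCost_of_covers hcov', Nat.cast_le] at h1
  have hsplit : ∀ f : V → ℕ, ∑ u, f u = ∑ u ∈ W, f u + ∑ u ∈ Wᶜ, f u := fun f =>
    (Finset.sum_add_sum_compl W f).symm
  rw [hsplit, hsplit fun u => (s' u).1.card] at h1
  have h2 : ∑ u ∈ Wᶜ, (s' u).1.card ≤ ∑ u ∈ Wᶜ, (s u).1.card := by
    refine Finset.sum_le_sum fun u hu => Finset.card_le_card fun x hx => ?_
    rw [hmem, if_neg (Finset.mem_compl.1 hu)] at hx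
    exact hx.2
  have h3 : ∑ u ∈ W, (s' u).1.card + ∑ u ∈ W, ((s u).1 ∩ W).card ≤
      ∑ u ∈ W, (s u).1.card + ∑ u ∈ W, (T u).card := by
    rw [← Finset.sum_add_distrib, ← Finset.sum_add_distrib]
    refine Finset.sum_le_sum fun u hu => ?_
    have e1 : (s' u).1.card ≤ (((s u).1 \ W) ∪ T u).card := by
      refine Finset.card_le_card fun x hx => ?_
      rw [hmem, if_pos hu] at hx
      exact hx.2
    have e2 := Finset.card_union_le ((s u).1 \ W) (T u)
    have e3 := Finset.card_sdiff_add_card_inter (s u).1 W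
    omega
  omega

-- Only an inequality, since an edge may have been bought by both of its endpoints.
open Classical in
theorem sum_card_filter_adj_le {V : Type*} [DecidableEq V] (s : Profile V) (W : Finset V) :
    ∑ u ∈ W, (W.filter fun x => (network s).Adj u x).card ≤
      2 * ∑ u ∈ W, ((s u).1 ∩ W).card := by
  have h1 : ∀ u ∈ W, (W.filter fun x => (network s).Adj u x).card ≤
      ((s u).1 ∩ W).card + (W.filter fun x => u ∈ (s x).1).card := by
    intro u _
    refine le_trans (Finset.card_le_card fun x hx => ?_) (Finset.card_union_le _ _)
    obtain ⟨hxW, hx⟩ := Finset.mem_filter.1 hx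
    rcases hx with hx | hx
    · exact Finset.mem_union_left _ (Finset.mem_inter.2 ⟨hx, hxW⟩)
    · exact Finset.mem_union_right _ (Finset.mem_filter.2 ⟨hxW, hx⟩)
  have h2 : ∑ u ∈ W, (W.filter fun x => u ∈ (s x).1).card = ∑ u ∈ W, ((s u).1 ∩ W).card := by
    refine (Finset.sum_card_bipartiteAbove_eq_sum_card_bipartiteBelow (s := W) (t := W)
      (fun u x => u ∈ (s x).1)).trans (Finset.sum_congr rfl fun u _ => ?_)
    congr 1
    ext x
    simp [Finset.mem_bipartiteBelow, and_comm]
  refine (Finset.sum_le_sum h1).trans ?_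
  rw [Finset.sum_add_distrib, h2]
  omega

/-! ### Peeling off one agent at a time -/

/-- The replacement of the edges inside any set of agents by fewer than three edges per agent. -/
def HasSparseServingGraphs (V : Type*) [MetricSpace V] : Prop :=
  ∀ W : Finset V, W.Nonempty → ∃ T : V → Finset V, ∑ u ∈ W, (T u).card < 3 * W.card ∧
    ∀ u ∈ W, ∀ t, (∃ w ∈ W, dist w t < dist u t) →
      ∃ x ∈ W, (x ∈ T u ∨ u ∈ T x) ∧ dist x t < dist u t

open Classical in
theorem exists_agent_degree_le [Fintype V] (hV : HasSparseServingGraphs V) {s : Profile V}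
    (hs : ∀ s' : Profile V, socialCost s ≤ socialCost s') {W : Finset V} (hW : W.Nonempty) :
    ∃ y ∈ W, ∀ S : Finset V, Covers y (fun x => ((network s).Adj y x ∧ x ∉ W) ∨ x ∈ S) →
      (W.filter fun x => (network s).Adj y x).card ≤ S.card + 2 := by
  by_contra! hcon
  have hS : ∀ u, ∃ S : Finset V, u ∈ W →
      Covers u (fun x => ((network s).Adj u x ∧ x ∉ W) ∨ x ∈ S) ∧
        S.card + 2 < (W.filter fun x => (network s).Adj u x).card := by
    intro u
    by_cases hu : u ∈ W
    · obtain ⟨S, hS⟩ := hcon u hu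
      exact ⟨S, fun _ => hS⟩
    · exact ⟨∅, fun hu' => absurd hu' hu⟩
  choose S hS using hS
  have h1 := sum_card_inter_le_of_optimal hs W S fun u hu =>
    (hS u hu).1.mono fun x hx => hx.imp_right Or.inl
  have h2 : ∑ u ∈ W, ((S u).card + 3) ≤
      ∑ u ∈ W, (W.filter fun x => (network s).Adj u x).card :=
    Finset.sum_le_sum fun u hu => (hS u hu).2
  rw [Finset.sum_add_distrib, Finset.sum_const, smul_eq_mul] at h2
  have h3 := sum_card_filter_adj_le s W
  -- `h1`, `h2` and `h3` force at least 3|W| purchases inside `W`; the sparse serving graph forces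
  -- fewer.
  obtain ⟨T, hTcard, hT⟩ := hV W hW
  have h4 := sum_card_inter_le_of_optimal hs W T fun u hu t ht => by
    obtain ⟨x, hx, hlt⟩ := covers_of_greedyConnected (greedyConnected_of_optimal hs u) t ht
    by_cases hxW : x ∈ W
    · obtain ⟨y, hyW, hy, hlt'⟩ := hT u hu t ⟨x, hxW, hlt⟩
      exact ⟨y, Or.inr (hy.imp_right fun h => ⟨hyW, h⟩), hlt'⟩
    · exact ⟨x, Or.inl ⟨hx, hxW⟩, hlt⟩
  omega

-- The last clause models a deviation of `u`: edges owned by others stay, those in `O u` are given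
-- up, and `S` is bought instead.
open Classical in
theorem exists_ownership [Fintype V] (hV : HasSparseServingGraphs V) {s : Profile V}
    (hs : ∀ s' : Profile V, socialCost s ≤ socialCost s') (W : Finset V) :
    ∃ O : V → Finset V, (∀ u ∈ W, ∀ v ∈ O u, v ∈ W ∧ (network s).Adj u v) ∧
      (∀ u ∈ W, ∀ v ∈ W, (network s).Adj u v → v ∈ O u ∨ u ∈ O v) ∧
      (∀ u ∈ W, ∀ v ∈ W, ¬ (v ∈ O u ∧ u ∈ O v)) ∧
      ∀ u ∈ W, ∀ S : Finset V,
        Covers u (fun x => ((network s).Adj u x ∧ x ∉ O u) ∨ x ∈ S) →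
          (O u).card ≤ S.card + 2 := by
  induction W using Finset.strongInduction with
  | H W ih =>
    rcases W.eq_empty_or_nonempty with rfl | hW
    · exact ⟨fun _ => ∅, by simp⟩
    obtain ⟨y, hy, hdeg⟩ := exists_agent_degree_le hV hs hW
    obtain ⟨O, h1, h2, h3, h4⟩ := ih (W.erase y) (Finset.erase_ssubset hy)
    set N := W.filter fun x => (network s).Adj y x with hN
    have hmemN : ∀ x, x ∈ N ↔ x ∈ W ∧ (network s).Adj y x := fun x => Finset.mem_filter
    have hne : ∀ {u}, u ≠ y → Function.update O y N u = O u := fun h =>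
      Function.update_of_ne h _ _
    have hnot : ∀ u ∈ W, u ≠ y → y ∉ O u := fun u hu huy hyO =>
      Finset.notMem_erase y W (h1 u (Finset.mem_erase.2 ⟨huy, hu⟩) y hyO).1
    refine ⟨Function.update O y N, ?_, ?_, ?_, ?_⟩
    · intro u hu v hv
      by_cases huy : u = y
      · subst huy
        rw [Function.update_self] at hv
        exact (hmemN v).1 hv
      · rw [hne huy] at hv
        have := h1 u (Finset.mem_erase.2 ⟨huy, hu⟩) v hv
        exact ⟨Finset.mem_of_mem_erase this.1, this.2⟩
    · intro u hu v hv huv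
      by_cases huy : u = y
      · subst huy
        rw [Function.update_self]
        exact Or.inl ((hmemN v).2 ⟨hv, huv⟩)
      by_cases hvy : v = y
      · subst hvy
        rw [Function.update_self]
        exact Or.inr ((hmemN u).2 ⟨hu, huv.symm⟩)
      rw [hne huy, hne hvy]
      exact h2 u (Finset.mem_erase.2 ⟨huy, hu⟩) v (Finset.mem_erase.2 ⟨hvy, hv⟩) huv
    · rintro u hu v hv ⟨hvu, huv⟩
      by_cases huy : u = y
      · subst huy
        by_cases hvu' : v = u
        · subst hvu'
          rw [Function.update_self] at huv
          exact ((hmemN v).1 huv).2.ne rfl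
        · rw [hne hvu'] at huv
          exact hnot v hv hvu' huv
      · rw [hne huy] at hvu
        by_cases hvy : v = y
        · subst hvy
          exact hnot u hu huy hvu
        · rw [hne hvy] at huv
          exact h3 u (Finset.mem_erase.2 ⟨huy, hu⟩) v (Finset.mem_erase.2 ⟨hvy, hv⟩) ⟨hvu, huv⟩
    · intro u hu S hS
      by_cases huy : u = y
      · subst huy
        rw [Function.update_self] at hS ⊢
        -- An edge of the peeled agent outside `N` leaves `W`, so it is among the edges that `hdeg`
        -- keeps for free.
        refine hdeg S (hS.mono fun x hx => hx.imp_left fun ⟨hadj, hx⟩ => ⟨hadj, fun hxW => ?_⟩)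
        exact hx ((hmemN x).2 ⟨hxW, hadj⟩)
      · rw [hne huy] at hS ⊢
        exact h4 u (Finset.mem_erase.2 ⟨huy, hu⟩) S hS

theorem exists_isAdditiveNE_two [Fintype V] (hV : HasSparseServingGraphs V) {G : SimpleGraph V}
    (hG : IsSocialOptimum G) :
    ∃ s : Profile V, IsOwnershipAssignment s G ∧ IsAdditiveNE 2 s := by
  classical
  obtain ⟨s, rfl, hs⟩ := hG
  obtain ⟨O, h1, h2, h3, h4⟩ := exists_ownership hV hs Finset.univ
  simp only [Finset.mem_univ, true_and, forall_true_left] at h1 h2 h3 h4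
  set r : Profile V := fun u => ⟨O u, fun hu => (h1 u u hu).ne rfl⟩ with hr
  have hnet : network r = network s := by
    ext u v
    refine ⟨fun h => ?_, fun h => h2 u v h⟩
    rcases h with h | h
    · exact h1 u v h
    · exact (h1 v u h).symm
  refine ⟨r, ⟨hnet, h3⟩, fun u S hlt => ?_⟩
  have hcost : cost r u = ((r u).1.card : ℕ∞) :=
    cost_of_greedyConnected (by rw [hnet]; exact greedyConnected_of_optimal hs u)
  rw [hcost] at hlt
  by_cases hc : GreedyConnected (network (Function.update r u S)) u
  · rw [cost_of_greedyConnected hc, Function.update_self] at hlt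
    have hcard := h4 u S.1 ((covers_of_greedyConnected hc).mono fun x hx => by
      rcases hx with hx | hx
      · rw [Function.update_self] at hx
        exact Or.inr hx
      · by_cases hxu : x = u
        · subst hxu
          rw [Function.update_self] at hx
          exact absurd hx S.2
        · rw [Function.update_of_ne hxu] at hx
          exact Or.inl ⟨(h1 x u hx).symm, fun hx' => h3 u x ⟨hx', hx⟩⟩)
    have : S.1.card + 2 < (O u).card := by exact_mod_cast hlt
    omega
  · rw [cost_of_not_greedyConnected hc, top_add] at hlt
    exact not_top_lt hlt

end Game

end GreedyGame

theorem mainTheorem3 (P : Finset (EuclideanSpace ℝ (Fin 2))) (G : SimpleGraph P)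
    (hG : GreedyGame.IsSocialOptimum G) :
    ∃ s : GreedyGame.Profile P,
      GreedyGame.IsOwnershipAssignment s G ∧ GreedyGame.IsAdditiveNE 2 s := by
  refine GreedyGame.exists_isAdditiveNE_two (fun W hW => ?_) hG
  obtain ⟨T, hcard, hT⟩ := exists_sparse_serving_graph
    (p := fun x : P => (x : EuclideanSpace ℝ (Fin 2))) Subtype.val_injective hW
  exact ⟨T, hcard, fun u hu t h => hT u hu t h⟩
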